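/- Let $M$ be a smooth ($C^\infty$, Hausdorff, second countable) $m$-dimensional manifold, $U\subseteq\mathbb R^k$ an open set, $X\colon M\times U\to TM$ a smooth vector field along the projection $M\times U\to M$ (a control system), and $F\colon M\times U\to\mathbb R$ a smooth cost function. On $T^*M\times U$ let $\Omega$ be the pull-back of the canonical $2$-form $dx^i\wedge dp_i$ of $T^*M$, and for $p_0\in\{0,-1\}$ let $H^{[p_0]}(\lambda,u)=\langle\lambda,X(x,u)\rangle+p_0F(x,u)$, $\lambda\in T_x^*M$. For each $p_0$ run the presymplectic constraint algorithm for $H=H^{[p_0]}$: let $N_0$ be the set of points $q\in T^*M\times U$ at which $i_v\Omega=d_qH$ has a solution $v\in T_q(T^*M\times U)$, and $\mathfrak X^{N_0}$ the set of smooth vector fields $Z$ on $T^*M\times U$ with $i_Z\Omega=dH$ at all points of $N_0$. Inductively let $N_{i+1}$ be the set of $q\in N_i$ such that $Z(q)\in T_qN_i$ for some $Z\in\mathfrak X^{N_i}$, and $\mathfrak X^{N_{i+1}}$ the set of $Z\in\mathfrak X^{N_i}$ with $Z(q)\in T_qN_i$ for all $q\in N_{i+1}$. (Here $T_qN$ is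 the set of velocities at $q$ of smooth curves in $N$ through $q$, which is the usual tangent space if $N$ is an embedded submanifold.) Let $N_f^{[p_0]}=\bigcap_iN_i$ and $\mathfrak X_f^{[p_0]}=\bigcap_i\mathfrak X^{N_i}$. A curve $\gamma\colon[a,b]\to M$, $a<b$, is called an abnormal (resp. normal) extremal if for some control $u\colon[a,b]\to U$ and some curve $\lambda\colon[a,b]\to T^*M$ along $\gamma$, with $p_0=0$ (resp. $p_0=-1$): (1) $(\lambda,u)$ is differentiable and $i_{(\dot\lambda(t),\dot u(t))}\Omega=dH^{[p_0]}(\lambda(t),u(t))$ for all $t\in[a,b]$; (2a) $H^{[p_0]}(\lambda(t),u(t))$ is constant on $[a,b]$; (2b) $(p_0,\lambda(t))\neq0$ for all $t\in[a,b]$. **Proposition.** Let $(\lambda^{[0]},u^{[0]})$ and $(\lambda^{[-1]},u^{[-1]})$ be curves $[a,b]\to T^*M\times U$ such that, for $p_0=0$ and for $p_0=-1$, $(\lambda^{[p_0]},u^{[p_0]})$ lies in $N_f^{[p_0]}$ and is an integral curve of some vector field in $\mathfrak X_f^{[p_0]}$. Suppose that $\lambda^{[0]}$ is not identically zero and that $\lambda^{[0]}$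 and $\lambda^{[-1]}$ project to the same curve $\gamma\colon[a,b]\to M$. Then $\gamma$ is both an abnormal extremal and a normal extremal. -/

import Mathlib

open scoped Manifold ContDiff Topology

noncomputable section

namespace OptimalControl

section

variable {m k : ℕ}

/-- An optimal control system on the manifold `M` with open control set `U ⊆ ℝᵏ`: a smooth vector
field `X` along the projection `M × U → M`, and a smooth cost function `F : M × U → ℝ`. -/
structure System (m k : ℕ) (M : Type*) [TopologicalSpace M]
    [ChartedSpace (EuclideanSpace ℝ (Fin m)) M] [IsManifold (𝓡 m) ∞ M]
    (U : TopologicalSpace.Opens (EuclideanSpace ℝ (Fin k))) where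
  /-- the control system, `X (x, u) ∈ T_x M` -/
  X : (x : M) → U → TangentSpace (𝓡 m) x
  smooth_X : ContMDiff ((𝓡 m).prod (𝓡 k)) (𝓡 m).tangent ∞
    (fun q : M × U => (⟨q.1, X q.1 q.2⟩ : TangentBundle (𝓡 m) M))
  /-- the cost function -/
  F : M × U → ℝ
  smooth_F : ContMDiff ((𝓡 m).prod (𝓡 k)) 𝓘(ℝ, ℝ) ∞ F

/-- The cotangent bundle `T*M`: points are pairs `⟨x, p⟩` with `p : T_x M →L[ℝ] ℝ`. Its topology
and smooth structure are those of Mathlib's bundle of continuous linear maps `TM → M × ℝ`. -/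
abbrev Cotangent (m : ℕ) (M : Type*) [TopologicalSpace M]
    [ChartedSpace (EuclideanSpace ℝ (Fin m)) M] [IsManifold (𝓡 m) ∞ M] : Type _ :=
  Bundle.TotalSpace (EuclideanSpace ℝ (Fin m) →L[ℝ] ℝ)
    (fun x : M => TangentSpace (𝓡 m) x →L[ℝ] Bundle.Trivial M ℝ x)

/-- Model with corners of `T*M`; the model vector space is `ℝᵐ × (ℝᵐ)*`. -/
abbrev cotangentModel (m : ℕ) := (𝓡 m).prod 𝓘(ℝ, EuclideanSpace ℝ (Fin m) →L[ℝ] ℝ)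

/-- Model with corners of `T*M × U`. -/
abbrev phaseModel (m k : ℕ) := (cotangentModel m).prod (𝓡 k)

variable {M : Type*} [TopologicalSpace M] [ChartedSpace (EuclideanSpace ℝ (Fin m)) M]
  [IsManifold (𝓡 m) ∞ M] {U : TopologicalSpace.Opens (EuclideanSpace ℝ (Fin k))}

/-- The canonical symplectic form `dxⁱ ∧ dpᵢ` of `T*M` at `β`. The preferred chart of `T*M` at `β`
consists of the natural coordinates `(x, p)` induced by the chart of `M` at the base point of `β`,
and tangent vectors at `β` are represented by their components `(v_x, v_p)` in that chart; in
natural coordinates the canonical form is `(v, w) ↦ w_p(v_x) - v_p(w_x)`. -/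
def canonicalForm (β : Cotangent m M) (v w : TangentSpace (cotangentModel m) β) : ℝ :=
  let v' : EuclideanSpace ℝ (Fin m) × (EuclideanSpace ℝ (Fin m) →L[ℝ] ℝ) := v
  let w' : EuclideanSpace ℝ (Fin m) × (EuclideanSpace ℝ (Fin m) →L[ℝ] ℝ) := w
  w'.2 v'.1 - v'.2 w'.1

/-- The presymplectic form `Ω` on `T*M × U`, the pull-back of the canonical form along the
projection `T*M × U → T*M`. -/
def presymplecticForm (q : Cotangent m M × U) (v w : TangentSpace (phaseModel m k) q) : ℝ :=
  canonicalForm q.1 (mfderiv (phaseModel m k) (cotangentModel m) Prod.fst q v)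
    (mfderiv (phaseModel m k) (cotangentModel m) Prod.fst q w)

/-- The equation `i_v Ω = d_q H` for a tangent vector `v` at `q ∈ T*M × U`. -/
def SolvesAt (H : Cotangent m M × U → ℝ) (q : Cotangent m M × U)
    (v : TangentSpace (phaseModel m k) q) : Prop :=
  ∀ w : TangentSpace (phaseModel m k) q,
    presymplecticForm q v w = (mfderiv (phaseModel m k) 𝓘(ℝ, ℝ) H q w : ℝ)

/-- Pontryagin's Hamiltonian `H(λ, u) = ⟨λ, X(x, u)⟩ + p₀ F(x, u)` for `λ ∈ T*_x M`. -/
def System.hamiltonian (S : System m k M U) (p₀ : ℝ) (q : Cotangent m M × U) : ℝ :=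
  (q.1.2 (S.X q.1.1 q.2) : ℝ) + p₀ * S.F (q.1.1, q.2)

/-! ### The presymplectic constraint algorithm -/

/-- Tangent vectors to a subset `N` of `T*M × U`: the velocities `c'(0)` of smooth curves `c` which
lie in `N` for small times. For a (regular) submanifold this is the usual tangent bundle. -/
def tangentSet (N : Set (Cotangent m M × U)) :
    Set (TangentBundle (phaseModel m k) (Cotangent m M × U)) :=
  {ξ | ∃ c : ℝ → Cotangent m M × U, ContMDiffAt 𝓘(ℝ, ℝ) (phaseModel m k) ∞ c 0 ∧
    (∀ᶠ t in 𝓝 (0 : ℝ), c t ∈ N) ∧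
    ξ = ⟨c 0, mfderiv 𝓘(ℝ, ℝ) (phaseModel m k) c 0 (1 : ℝ)⟩}

/-- (Not necessarily smooth) vector fields on `T*M × U`. -/
abbrev VField (m k : ℕ) (M : Type*) [TopologicalSpace M]
    [ChartedSpace (EuclideanSpace ℝ (Fin m)) M] [IsManifold (𝓡 m) ∞ M]
    (U : TopologicalSpace.Opens (EuclideanSpace ℝ (Fin k))) : Type _ :=
  (q : Cotangent m M × U) → TangentSpace (phaseModel m k) q

/-- The vector `Z(q)` is tangent to `N`, i.e. `Z(q) ∈ T_q N`. -/
def TangentAt (Z : VField m k M U) (N : Set (Cotangent m M × U)) (q : Cotangent m M × U) : Prop :=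
  (⟨q, Z q⟩ : TangentBundle (phaseModel m k) (Cotangent m M × U)) ∈ tangentSet N

/-- The primary constraint set `N₀`: the points at which `i_v Ω = dH` has a solution `v`. -/
def primarySet (H : Cotangent m M × U → ℝ) : Set (Cotangent m M × U) :=
  {q | ∃ v : TangentSpace (phaseModel m k) q, SolvesAt H q v}

/-- `X^{N₀}`: the smooth vector fields on `T*M × U` which solve `i_Z Ω = dH` on `N₀`. -/
def primaryFields (H : Cotangent m M × U → ℝ) : Set (VField m k M U) :=
  {Z | ContMDiff (phaseModel m k) (phaseModel m k).tangent ∞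
      (fun q => (⟨q, Z q⟩ : TangentBundle (phaseModel m k) (Cotangent m M × U))) ∧
    ∀ q ∈ primarySet H, SolvesAt H q (Z q)}

/-- The points of `N` at which some vector field of the family `𝒳` is tangent to `N`. -/
def nextSet (N : Set (Cotangent m M × U)) (𝒳 : Set (VField m k M U)) : Set (Cotangent m M × U) :=
  {q ∈ N | ∃ Z ∈ 𝒳, TangentAt Z N q}

/-- The pairs `(Nᵢ, X^{Nᵢ})` of the constraint algorithm. `N_{i+1}` is the set of points of `Nᵢ` at
which some element of `X^{Nᵢ}` is tangent to `Nᵢ`, and `X^{N_{i+1}}` is the set of the elements of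
`X^{Nᵢ}` which are tangent to `Nᵢ` at the points of `N_{i+1}`. -/
def constraintPair (H : Cotangent m M × U → ℝ) :
    ℕ → Set (Cotangent m M × U) × Set (VField m k M U)
  | 0 => (primarySet H, primaryFields H)
  | i + 1 =>
    (nextSet (constraintPair H i).1 (constraintPair H i).2,
      {Z ∈ (constraintPair H i).2 |
        ∀ q ∈ nextSet (constraintPair H i).1 (constraintPair H i).2,
          TangentAt Z (constraintPair H i).1 q})

/-- The final constraint set `N_f = ⋂ᵢ Nᵢ`. -/
def finalSet (H : Cotangent m M × U → ℝ) : Set (Cotangent m M × U) :=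
  ⋂ i, (constraintPair H i).1

/-- The final family of vector fields `X^{N_f} = ⋂ᵢ X^{Nᵢ}`. -/
def finalFields (H : Cotangent m M × U → ℝ) : Set (VField m k M U) :=
  ⋂ i, (constraintPair H i).2

/-- The curve `(λ, u) : [a, b] → T*M × U` belongs to the solution `(N_f, X^{N_f})` of the constraint
algorithm: it lies in `N_f` and it is an integral curve of a vector field of `X^{N_f}`. -/
def IsFinalCurve (H : Cotangent m M × U → ℝ) (a b : ℝ) (lam : ℝ → Cotangent m M) (u : ℝ → U) :
    Prop :=
  (∀ t ∈ Set.Icc a b, (lam t, u t) ∈ finalSet H) ∧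
    ∃ Z ∈ finalFields H,
      IsMIntegralCurveOn (I := phaseModel m k) (fun t => (lam t, u t)) Z (Set.Icc a b)

/-! ### Extremals -/

/-- `(λ, u) : [a, b] → T*M × U` satisfies, with the constant `p₀`, the necessary conditions of
Pontryagin's Maximum Principle in presymplectic form:
(1) its velocity `v` at each time satisfies `i_v Ω = dH`;
(2a) `H` is constant along it; (2b) `(p₀, λ(t)) ≠ 0` for every `t`. -/
def System.SatisfiesPMP (S : System m k M U) (p₀ : ℝ) (a b : ℝ) (lam : ℝ → Cotangent m M)
    (u : ℝ → U) : Prop :=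
  (∀ t ∈ Set.Icc a b, ∃ v : TangentSpace (phaseModel m k) (lam t, u t),
    HasMFDerivWithinAt 𝓘(ℝ, ℝ) (phaseModel m k) (fun s => (lam s, u s)) (Set.Icc a b) t
      ((1 : ℝ →L[ℝ] ℝ).smulRight v) ∧
    SolvesAt (S.hamiltonian p₀) (lam t, u t) v) ∧
  (∃ h : ℝ, ∀ t ∈ Set.Icc a b, S.hamiltonian p₀ (lam t, u t) = h) ∧
  (∀ t ∈ Set.Icc a b, ¬ (p₀ = 0 ∧ (lam t).2 = 0))

/-- `(γ, u) : [a, b] → M × U` is an extremal with constant `p₀`: there is `λ : [a, b] → T*M` along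
`γ` such that `(λ, u)` satisfies the necessary conditions of Pontryagin's Maximum Principle. -/
def System.IsExtremalWith (S : System m k M U) (p₀ : ℝ) (a b : ℝ) (γ : ℝ → M) (u : ℝ → U) : Prop :=
  ∃ lam : ℝ → Cotangent m M, (∀ t ∈ Set.Icc a b, (lam t).1 = γ t) ∧ S.SatisfiesPMP p₀ a b lam u

/-- Normal extremals: `p₀ = -1`. -/
def System.IsNormalExtremal (S : System m k M U) (a b : ℝ) (γ : ℝ → M) (u : ℝ → U) : Prop :=
  S.IsExtremalWith (-1) a b γ u

/-- Abnormal extremals: `p₀ = 0`. -/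
def System.IsAbnormalExtremal (S : System m k M U) (a b : ℝ) (γ : ℝ → M) (u : ℝ → U) : Prop :=
  S.IsExtremalWith 0 a b γ u

end

end OptimalControl

end

noncomputable section

namespace OptimalControl

/-! Stage zero of the constraint algorithm already yields condition (1): the final set lies in
`primarySet`, the final fields lie in `primaryFields`, so every velocity `v` solves `i_v Ω = dH`.
Condition (2a) follows because the derivative of `H` along the curve is `dH(v) = Ω(v, v) = 0`.

Condition (2b) has content only for `p₀ = 0`. In natural coordinates `H(x, p, u) = p (X (x, u))`, so
the momentum satisfies the homogeneous linear equation `p' = -p ∘ ∂ₓX`. A momentum that vanishes at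
one time therefore vanishes nearby (`System.eventually_eq_zero_iff`), and by connectedness on all of
`[a, b]` (`System.eq_zero_of_eq_zero`), against the hypothesis on `λ^{[0]}`.

The geometric work lies in reading Hamilton's equation in one fixed chart: `canonicalForm` at `β` is
defined by the chart centred at `β`, which moves along the curve. `canonicalForm_eq_standardForm`
removes this dependence, since chart changes of `T*M` are cotangent lifts. -/

/-! ### Cotangent lifts preserve the standard symplectic form. -/

/-- The canonical symplectic form of `E × E*`. -/
def standardForm {E : Type*} [NormedAddCommGroup E] [NormedSpace ℝ E]
    (v w : E × (E →L[ℝ] ℝ)) : ℝ :=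
  w.2 v.1 - v.2 w.1

/-- The cotangent lift of a change of coordinates `τ` with inverse `σ` is symplectic. -/
theorem standardForm_cotangentLift {E : Type*} [NormedAddCommGroup E] [NormedSpace ℝ E]
    {σ τ : E → E} {τ' : E →L[ℝ] E} {y : E} (p : E →L[ℝ] ℝ)
    (hσ : ContDiffAt ℝ 2 σ (τ y)) (hτ : HasFDerivAt τ τ' y)
    (hστ : ∀ e, fderiv ℝ σ (τ y) (τ' e) = e) :
    ∃ D : E × (E →L[ℝ] ℝ) →L[ℝ] E × (E →L[ℝ] ℝ),
      HasFDerivAt (fun z : E × (E →L[ℝ] ℝ) => (τ z.1, z.2.comp (fderiv ℝ σ (τ z.1)))) D (y, p) ∧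
      ∀ v w, standardForm (D v) (D w) = standardForm v w := by
  have hsym : IsSymmSndFDerivAt ℝ σ (τ y) := hσ.isSymmSndFDerivAt (by simp)
  have hσ2 : HasFDerivAt (fderiv ℝ σ) (fderiv ℝ (fderiv ℝ σ) (τ y)) (τ y) :=
    ((hσ.fderiv_right (m := 1) (by norm_num)).differentiableAt one_ne_zero).hasFDerivAt
  have h1 : HasFDerivAt (fun z : E × (E →L[ℝ] ℝ) => τ z.1)
      (τ'.comp (ContinuousLinearMap.fst ℝ E (E →L[ℝ] ℝ))) (y, p) :=
    HasFDerivAt.comp (y, p) (g := τ) hτ hasFDerivAt_fst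
  have h2 : HasFDerivAt (fun z : E × (E →L[ℝ] ℝ) => fderiv ℝ σ (τ z.1)) _ (y, p) :=
    HasFDerivAt.comp (y, p) (g := fderiv ℝ σ) hσ2 h1
  have h3 := (hasFDerivAt_snd (𝕜 := ℝ) (p := (y, p))).clm_comp h2
  refine ⟨_, h1.prodMk h3, fun v w => ?_⟩
  -- The only extra terms in `standardForm (D v) (D w)` are `p` applied to the second derivative of
  -- `σ` at `(τ' w.1, τ' v.1)` and at the swapped pair, with opposite signs; symmetry cancels them.
  have := hsym.eq (τ' v.1) (τ' w.1)
  simp [standardForm, hστ, this]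

/-! ### Natural coordinates on the cotangent bundle. -/

variable {m k : ℕ} {M : Type*} [TopologicalSpace M]
  [ChartedSpace (EuclideanSpace ℝ (Fin m)) M] [IsManifold (𝓡 m) ∞ M]
  {U : TopologicalSpace.Opens (EuclideanSpace ℝ (Fin k))}

theorem cotangent_extChartAt (β₀ β : Cotangent m M) :
    extChartAt (cotangentModel m) β₀ β = (extChartAt (𝓡 m) β₀.1 β.1,
      (β.2.comp ((trivializationAt (EuclideanSpace ℝ (Fin m)) (TangentSpace (𝓡 m)) β₀.1).symmL ℝ β.1)
        : EuclideanSpace ℝ (Fin m) →L[ℝ] ℝ)) := by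
  rw [FiberBundle.extChartAt]
  simp [hom_trivializationAt_apply, ContinuousLinearMap.inCoordinates]

theorem mem_cotangent_extChartAt_source {β₀ β : Cotangent m M} :
    β ∈ (extChartAt (cotangentModel m) β₀).source ↔ β.1 ∈ (extChartAt (𝓡 m) β₀.1).source := by
  rw [extChartAt_source, extChartAt_source, FiberBundle.chartedSpace_chartAt]
  simp +contextual

theorem symmL_trivializationAt_continuousLinearMapAt {x₀ x : M}
    (hx : x ∈ (extChartAt (𝓡 m) x₀).source) (e : TangentSpace (𝓡 m) x) :
    (trivializationAt (EuclideanSpace ℝ (Fin m)) (TangentSpace (𝓡 m)) x₀).symmL ℝ x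
      ((trivializationAt (EuclideanSpace ℝ (Fin m)) (TangentSpace (𝓡 m)) x₀).continuousLinearMapAt
        ℝ x e) = e :=
  Bundle.Trivialization.symmL_continuousLinearMapAt _ (by simpa using hx) e

theorem continuousLinearMapAt_trivializationAt_symmL {x₀ x : M}
    (hx : x ∈ (extChartAt (𝓡 m) x₀).source) (e : EuclideanSpace ℝ (Fin m)) :
    (trivializationAt (EuclideanSpace ℝ (Fin m)) (TangentSpace (𝓡 m)) x₀).continuousLinearMapAt ℝ x
      ((trivializationAt (EuclideanSpace ℝ (Fin m)) (TangentSpace (𝓡 m)) x₀).symmL ℝ x e) = e :=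
  Bundle.Trivialization.continuousLinearMapAt_symmL _ (by simpa using hx) e

theorem cotangent_extChartAt_symm (β₀ : Cotangent m M)
    {z : EuclideanSpace ℝ (Fin m) × (EuclideanSpace ℝ (Fin m) →L[ℝ] ℝ)}
    (hz : z.1 ∈ (extChartAt (𝓡 m) β₀.1).target) :
    (extChartAt (cotangentModel m) β₀).symm z =
      ⟨(extChartAt (𝓡 m) β₀.1).symm z.1, z.2.comp
        ((trivializationAt (EuclideanSpace ℝ (Fin m)) (TangentSpace (𝓡 m)) β₀.1).continuousLinearMapAt
          ℝ ((extChartAt (𝓡 m) β₀.1).symm z.1))⟩ := by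
  have hx := (extChartAt (𝓡 m) β₀.1).map_target hz
  rw [← (extChartAt (cotangentModel m) β₀).left_inv (x := ⟨_, _⟩)
    (mem_cotangent_extChartAt_source.2 hx), cotangent_extChartAt]
  congr 1
  refine Prod.ext ((extChartAt (𝓡 m) β₀.1).right_inv hz).symm ?_
  ext1 e
  exact congrArg z.2 (continuousLinearMapAt_trivializationAt_symmL hx e).symm

/-- Momenta are read through trivializations of `TM`; expressing their transition maps as
derivatives of chart changes of `M` exhibits the chart changes of `T*M` as cotangent lifts. -/
theorem continuousLinearMapAt_symmL_eq_fderiv {x₀ x₁ x : M}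
    (h₀ : x ∈ (extChartAt (𝓡 m) x₀).source) (h₁ : x ∈ (extChartAt (𝓡 m) x₁).source)
    (e : EuclideanSpace ℝ (Fin m)) :
    (trivializationAt (EuclideanSpace ℝ (Fin m)) (TangentSpace (𝓡 m)) x₁).continuousLinearMapAt ℝ x
      ((trivializationAt (EuclideanSpace ℝ (Fin m)) (TangentSpace (𝓡 m)) x₀).symmL ℝ x e) =
    fderiv ℝ (extChartAt (𝓡 m) x₁ ∘ (extChartAt (𝓡 m) x₀).symm) (extChartAt (𝓡 m) x₀ x) e := by
  rw [TangentBundle.continuousLinearMapAt_trivializationAt_eq_core (by simpa using h₁),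
    TangentBundle.symmL_trivializationAt_eq_core (by simpa using h₀)]
  refine (tangentCoordChange_comp (I := 𝓡 m) ⟨⟨h₀, mem_extChartAt_source x⟩, h₁⟩).trans ?_
  rw [tangentCoordChange_def, ModelWithCorners.Boundaryless.range_eq_univ, fderivWithin_univ]

/-- The charts of `T*M` are symplectic. -/
theorem canonicalForm_eq_standardForm {β₀ β : Cotangent m M}
    (hβ : β ∈ (extChartAt (cotangentModel m) β₀).source)
    (v w : TangentSpace (cotangentModel m) β) :
    canonicalForm β v w = standardForm
      (mfderiv (cotangentModel m) 𝓘(ℝ, EuclideanSpace ℝ (Fin m) × (EuclideanSpace ℝ (Fin m) →L[ℝ] ℝ))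
        (extChartAt (cotangentModel m) β₀) β v)
      (mfderiv (cotangentModel m) 𝓘(ℝ, EuclideanSpace ℝ (Fin m) × (EuclideanSpace ℝ (Fin m) →L[ℝ] ℝ))
        (extChartAt (cotangentModel m) β₀) β w) := by
  have h₀ : β.1 ∈ (extChartAt (𝓡 m) β₀.1).source := mem_cotangent_extChartAt_source.1 hβ
  have h₁ : β.1 ∈ (extChartAt (𝓡 m) β.1).source := mem_extChartAt_source β.1
  have hmd : MDifferentiableAt (cotangentModel m)
      𝓘(ℝ, EuclideanSpace ℝ (Fin m) × (EuclideanSpace ℝ (Fin m) →L[ℝ] ℝ))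
      (extChartAt (cotangentModel m) β₀) β :=
    mdifferentiableAt_extChartAt (by simpa using hβ)
  -- `τ` passes from the chart centred at `β.1` to the one at `β₀.1`, and `σ` goes back; covectors
  -- transform by the derivative of `σ`.
  set σ := extChartAt (𝓡 m) β.1 ∘ (extChartAt (𝓡 m) β₀.1).symm with hσdef
  set τ := extChartAt (𝓡 m) β₀.1 ∘ (extChartAt (𝓡 m) β.1).symm with hτdef
  set y := extChartAt (𝓡 m) β.1 β.1 with hy
  have hsymm : (extChartAt (𝓡 m) β.1).symm y = β.1 := extChartAt_to_inv β.1
  have hτy : τ y = extChartAt (𝓡 m) β₀.1 β.1 :=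
    congrArg (extChartAt (𝓡 m) β₀.1) hsymm
  have hσ : ContDiffAt ℝ ∞ σ (τ y) := by
    rw [hτy]
    have := contDiffWithinAt_ext_coord_change (I := 𝓡 m) (n := ∞) β.1 β₀.1
      (y := extChartAt (𝓡 m) β₀.1 β.1) (by
        rw [PartialEquiv.trans_source'', PartialEquiv.symm_symm, PartialEquiv.symm_target]
        exact Set.mem_image_of_mem _ ⟨h₀, h₁⟩)
    rwa [ModelWithCorners.Boundaryless.range_eq_univ, contDiffWithinAt_univ] at this
  have hτ := hasFDerivWithinAt_tangentCoordChange (I := 𝓡 m) (x := β.1) (y := β₀.1) (z := β.1)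
    ⟨h₁, h₀⟩
  rw [ModelWithCorners.Boundaryless.range_eq_univ, hasFDerivWithinAt_univ] at hτ
  have hnear : ∀ᶠ z in 𝓝 y, z ∈ (extChartAt (𝓡 m) β.1).target ∧
      (extChartAt (𝓡 m) β.1).symm z ∈ (extChartAt (𝓡 m) β₀.1).source := by
    refine Filter.Eventually.and (extChartAt_target_mem_nhds β.1) ?_
    refine (continuousAt_extChartAt_symm β.1).preimage_mem_nhds ?_
    rw [hsymm]
    exact extChartAt_source_mem_nhds' h₀
  have hστ : ∀ e, fderiv ℝ σ (τ y) (tangentCoordChange (𝓡 m) β.1 β₀.1 β.1 e) = e := by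
    have hcomp : HasFDerivAt (σ ∘ τ)
        ((fderiv ℝ σ (τ y)).comp (tangentCoordChange (𝓡 m) β.1 β₀.1 β.1)) y :=
      ((hσ.differentiableAt (by simp)).hasFDerivAt).comp y hτ
    have hid : σ ∘ τ =ᶠ[𝓝 y] id := by
      filter_upwards [hnear] with z hz
      exact (congrArg (extChartAt (𝓡 m) β.1) ((extChartAt (𝓡 m) β₀.1).left_inv hz.2)).trans
        ((extChartAt (𝓡 m) β.1).right_inv hz.1)
    intro e
    have := hcomp.unique ((hasFDerivAt_id y).congr_of_eventuallyEq hid)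
    exact congrArg (fun L : EuclideanSpace ℝ (Fin m) →L[ℝ] _ => L e) this
  obtain ⟨D, hD, hDsymp⟩ := standardForm_cotangentLift
    (extChartAt (cotangentModel m) β β).2 (hσ.of_le (by norm_cast)) hτ hστ
  have hfst : (extChartAt (cotangentModel m) β β).1 = y := by rw [cotangent_extChartAt]
  have heq : writtenInExtChartAt (cotangentModel m)
      𝓘(ℝ, EuclideanSpace ℝ (Fin m) × (EuclideanSpace ℝ (Fin m) →L[ℝ] ℝ)) β
      (extChartAt (cotangentModel m) β₀) =ᶠ[𝓝 (extChartAt (cotangentModel m) β β)]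
      fun z => (τ z.1, z.2.comp (fderiv ℝ σ (τ z.1))) := by
    have : ∀ᶠ z in 𝓝 (extChartAt (cotangentModel m) β β),
        z.1 ∈ (extChartAt (𝓡 m) β.1).target ∧
      (extChartAt (𝓡 m) β.1).symm z.1 ∈ (extChartAt (𝓡 m) β₀.1).source := by
      refine continuousAt_fst.eventually (p := fun z => z ∈ (extChartAt (𝓡 m) β.1).target ∧
        (extChartAt (𝓡 m) β.1).symm z ∈ (extChartAt (𝓡 m) β₀.1).source) ?_
      rw [hfst]; exact hnear
    filter_upwards [this] with z hz
    have : writtenInExtChartAt (cotangentModel m)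
      𝓘(ℝ, EuclideanSpace ℝ (Fin m) × (EuclideanSpace ℝ (Fin m) →L[ℝ] ℝ)) β
      (extChartAt (cotangentModel m) β₀) z = extChartAt (cotangentModel m) β₀
        ((extChartAt (cotangentModel m) β).symm z) := rfl
    rw [this, cotangent_extChartAt_symm _ hz.1, cotangent_extChartAt]
    refine Prod.ext rfl ?_
    ext1 e
    exact congrArg z.2 (continuousLinearMapAt_symmL_eq_fderiv hz.2
      ((extChartAt (𝓡 m) β.1).map_target hz.1) e)
  -- `mfderiv` at `β` is computed in the chart centred at `β`, the one that defines `canonicalForm`,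
  -- so it equals the derivative of the cotangent lift.
  have hmf : mfderiv (cotangentModel m)
      𝓘(ℝ, EuclideanSpace ℝ (Fin m) × (EuclideanSpace ℝ (Fin m) →L[ℝ] ℝ))
      (extChartAt (cotangentModel m) β₀) β = D := by
    rw [hmd.mfderiv, ModelWithCorners.Boundaryless.range_eq_univ, fderivWithin_univ,
      heq.fderiv_eq]
    refine HasFDerivAt.fderiv ?_
    have hpt : extChartAt (cotangentModel m) β β = (y, (extChartAt (cotangentModel m) β β).2) :=
      Prod.ext hfst rfl
    rw [hpt]
    exact hD
  rw [hmf]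
  exact (hDsymp v w).symm

/-! ### Smoothness of the Hamiltonian and its conservation. -/

theorem System.contMDiff_hamiltonian (S : System m k M U) (p₀ : ℝ) :
    ContMDiff (phaseModel m k) 𝓘(ℝ, ℝ) ∞ (S.hamiltonian p₀) := by
  have hproj : ContMDiff (phaseModel m k) ((𝓡 m).prod (𝓡 k)) ∞
      (fun q : Cotangent m M × U => ((q.1.1, q.2) : M × U)) :=
    ((Bundle.contMDiff_proj _).comp contMDiff_fst).prodMk contMDiff_snd
  have hF : ContMDiff (phaseModel m k) 𝓘(ℝ, ℝ) ∞
      (fun q : Cotangent m M × U => S.F (q.1.1, q.2)) := S.smooth_F.comp hproj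
  have hX : ContMDiff (phaseModel m k) (𝓡 m).tangent ∞
      (fun q : Cotangent m M × U => (⟨q.1.1, S.X q.1.1 q.2⟩ : TangentBundle (𝓡 m) M)) :=
    S.smooth_X.comp hproj
  have hp : ContMDiff (phaseModel m k) (cotangentModel m) ∞
      (fun q : Cotangent m M × U => (⟨q.1.1, q.1.2⟩ : Cotangent m M)) := contMDiff_fst
  have hpX := ContMDiff.clm_bundle_apply (F₂ := ℝ) (E₂ := Bundle.Trivial M ℝ)
    (b := fun q : Cotangent m M × U => q.1.1) (ϕ := fun q => q.1.2)
    (v := fun q => S.X q.1.1 q.2) hp hX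
  have hpX' : ContMDiff (phaseModel m k) 𝓘(ℝ, ℝ) ∞
      (fun q : Cotangent m M × U => (q.1.2 (S.X q.1.1 q.2) : ℝ)) := by
    intro q
    exact ((Bundle.contMDiffAt_totalSpace.1 (hpX q)).2)
  exact hpX'.add (contMDiff_const.mul hF)

theorem presymplecticForm_eq (q : Cotangent m M × U) (v w : TangentSpace (phaseModel m k) q) :
    presymplecticForm q v w = canonicalForm q.1 v.1 w.1 := by
  simp only [presymplecticForm, mfderiv_fst]
  rfl

theorem presymplecticForm_self (q : Cotangent m M × U) (v : TangentSpace (phaseModel m k) q) :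
    presymplecticForm q v v = 0 :=
  sub_self _

theorem IsFinalCurve.hasMFDerivWithinAt {H : Cotangent m M × U → ℝ} {a b : ℝ}
    {lam : ℝ → Cotangent m M} {u : ℝ → U} (h : IsFinalCurve H a b lam u) {t : ℝ}
    (ht : t ∈ Set.Icc a b) : ∃ v : TangentSpace (phaseModel m k) (lam t, u t),
      HasMFDerivWithinAt 𝓘(ℝ, ℝ) (phaseModel m k) (fun s => (lam s, u s)) (Set.Icc a b) t
        ((1 : ℝ →L[ℝ] ℝ).smulRight v) ∧ SolvesAt H (lam t, u t) v := by
  obtain ⟨hN, Z, hZ, hint⟩ := h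
  have hZ0 : Z ∈ primaryFields H := Set.mem_iInter.1 hZ 0
  have hN0 : (lam t, u t) ∈ primarySet H := Set.mem_iInter.1 (hN t ht) 0
  exact ⟨Z (lam t, u t), hint t ht, hZ0.2 _ hN0⟩

theorem hasDerivWithinAt_comp_of_hasMFDerivWithinAt {E H N F : Type*} [NormedAddCommGroup E]
    [NormedSpace ℝ E] [TopologicalSpace H] {I : ModelWithCorners ℝ E H} [TopologicalSpace N]
    [ChartedSpace H N] [NormedAddCommGroup F] [NormedSpace ℝ F] {f : N → F} {c : ℝ → N}
    {s : Set ℝ} {t : ℝ} {v : TangentSpace I (c t)} (hf : MDifferentiableAt I 𝓘(ℝ, F) f (c t))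
    (hc : HasMFDerivWithinAt 𝓘(ℝ, ℝ) I c s t ((1 : ℝ →L[ℝ] ℝ).smulRight v)) :
    HasDerivWithinAt (fun r => f (c r)) (mfderiv I 𝓘(ℝ, F) f (c t) v) s t := by
  -- Stated over the model spaces `E` and `F`, to which the tangent spaces unfold.
  have h : ∀ (A : E →L[ℝ] F) (w : E), HasFDerivWithinAt (fun r => f (c r))
      (A.comp ((1 : ℝ →L[ℝ] ℝ).smulRight w)) s t →
      HasDerivWithinAt (fun r => f (c r)) (A w) s t := fun A w hA =>
    hA.hasDerivWithinAt.congr_deriv (by simp)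
  exact h _ _ (hf.hasMFDerivAt.comp_hasMFDerivWithinAt t hc).hasFDerivWithinAt

/-- A differentiable function `H` is constant along the curves with `i_v Ω = dH`. -/
theorem exists_eq_of_solvesAt {H : Cotangent m M × U → ℝ}
    (hH : MDifferentiable (phaseModel m k) 𝓘(ℝ, ℝ) H) {a b : ℝ}
    {lam : ℝ → Cotangent m M} {u : ℝ → U}
    (h : ∀ t ∈ Set.Icc a b, ∃ v : TangentSpace (phaseModel m k) (lam t, u t),
      HasMFDerivWithinAt 𝓘(ℝ, ℝ) (phaseModel m k) (fun s => (lam s, u s)) (Set.Icc a b) t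
        ((1 : ℝ →L[ℝ] ℝ).smulRight v) ∧ SolvesAt H (lam t, u t) v) :
    ∃ c : ℝ, ∀ t ∈ Set.Icc a b, H (lam t, u t) = c := by
  have hderiv : ∀ t ∈ Set.Icc a b,
      HasDerivWithinAt (fun s => H (lam s, u s)) 0 (Set.Icc a b) t := by
    intro t ht
    obtain ⟨v, hv, hsol⟩ := h t ht
    -- The equation `i_v Ω = dH` is tested on `v` itself.
    exact (hasDerivWithinAt_comp_of_hasMFDerivWithinAt (hH _) hv).congr_deriv
      ((hsol v).symm.trans (presymplecticForm_self _ v))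
  refine ⟨H (lam a, u a), fun t ht => ?_⟩
  have ha : a ∈ Set.Icc a b := ⟨le_rfl, ht.1.trans ht.2⟩
  have := (convex_Icc a b).norm_image_sub_le_of_norm_hasDerivWithin_le (C := 0) hderiv
    (by simp) ha ht
  simpa [sub_eq_zero] using this

/-! ### Hamilton's equation for the momentum in coordinates. -/

/-- The control system in the coordinates of `M` around `x₀` and of `U` around `u₀`. -/
def System.localX (S : System m k M U) (x₀ : M) (u₀ : U)
    (z : EuclideanSpace ℝ (Fin m) × EuclideanSpace ℝ (Fin k)) : EuclideanSpace ℝ (Fin m) :=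
  (trivializationAt (EuclideanSpace ℝ (Fin m)) (TangentSpace (𝓡 m)) x₀
    ⟨(extChartAt (𝓡 m) x₀).symm z.1, S.X ((extChartAt (𝓡 m) x₀).symm z.1)
      ((extChartAt (𝓡 k) u₀).symm z.2)⟩).2

theorem System.contDiffAt_localX (S : System m k M U) (x₀ : M) (u₀ : U) :
    ContDiffAt ℝ ∞ (S.localX x₀ u₀) (extChartAt (𝓡 m) x₀ x₀, extChartAt (𝓡 k) u₀ u₀) := by
  have h1 := (Bundle.contMDiffAt_totalSpace.1 (S.smooth_X (x₀, u₀))).2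
  rw [contMDiffAt_iff] at h1
  have h2 := h1.2
  rw [ModelWithCorners.Boundaryless.range_eq_univ, contDiffWithinAt_univ] at h2
  exact h2

/-- The pairing of a covector with a vector does not depend on the trivialization. The resulting
linearity in the momentum is special to `p₀ = 0`. -/
theorem System.hamiltonian_zero_eq_localX (S : System m k M U) {β₀ β : Cotangent m M} {u₀ u : U}
    (hβ : β ∈ (extChartAt (cotangentModel m) β₀).source)
    (hu : u ∈ (extChartAt (𝓡 k) u₀).source) :
    S.hamiltonian 0 (β, u) = (extChartAt (cotangentModel m) β₀ β).2
      (S.localX β₀.1 u₀ ((extChartAt (cotangentModel m) β₀ β).1, extChartAt (𝓡 k) u₀ u)) := by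
  have hx := mem_cotangent_extChartAt_source.1 hβ
  rw [cotangent_extChartAt]
  dsimp only [System.localX, System.hamiltonian]
  rw [(extChartAt (𝓡 m) β₀.1).left_inv hx, (extChartAt (𝓡 k) u₀).left_inv hu, zero_mul, add_zero]
  have := symmL_trivializationAt_continuousLinearMapAt hx (S.X β.1 u)
  rw [Bundle.Trivialization.continuousLinearMapAt_apply,
    Bundle.Trivialization.coe_linearMapAt_of_mem _ (by simpa using hx)] at this
  exact (congrArg β.2 this).symm

/-- Hamilton's equation for the momenta, in the natural coordinates around `β₀`. -/
theorem System.snd_mfderiv_eq_of_solvesAt (S : System m k M U) {β₀ β : Cotangent m M} {u₀ u : U}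
    (hβ : β ∈ (extChartAt (cotangentModel m) β₀).source)
    (hu : u ∈ (extChartAt (𝓡 k) u₀).source)
    (hX : DifferentiableAt ℝ (S.localX β₀.1 u₀)
      ((extChartAt (cotangentModel m) β₀ β).1, extChartAt (𝓡 k) u₀ u))
    {v : TangentSpace (phaseModel m k) (β, u)} (hv : SolvesAt (S.hamiltonian 0) (β, u) v) :
    (mfderiv (cotangentModel m)
      𝓘(ℝ, EuclideanSpace ℝ (Fin m) × (EuclideanSpace ℝ (Fin m) →L[ℝ] ℝ))
      (extChartAt (cotangentModel m) β₀) β v.1).2 =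
    -((extChartAt (cotangentModel m) β₀ β).2.comp ((fderiv ℝ (S.localX β₀.1 u₀)
      ((extChartAt (cotangentModel m) β₀ β).1, extChartAt (𝓡 k) u₀ u)).comp
        (ContinuousLinearMap.inl ℝ _ _))) := by
  have hψ : MDifferentiableAt (cotangentModel m)
      𝓘(ℝ, EuclideanSpace ℝ (Fin m) × (EuclideanSpace ℝ (Fin m) →L[ℝ] ℝ))
      (extChartAt (cotangentModel m) β₀) β :=
    mdifferentiableAt_extChartAt (by simpa using hβ)
  have hsurj := (isInvertible_mfderiv_extChartAt (I := cotangentModel m) hβ).bijective.surjective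
  set z := extChartAt (cotangentModel m) β₀ β with hz
  set A := fderiv ℝ (S.localX β₀.1 u₀) (z.1, extChartAt (𝓡 k) u₀ u)
  -- `B` is the derivative of `(x, p) ↦ p (X (x, u))` with `u` frozen; only its `x`-part enters
  -- below.
  obtain ⟨B, hB, hloc⟩ : ∃ B : EuclideanSpace ℝ (Fin m) × (EuclideanSpace ℝ (Fin m) →L[ℝ] ℝ) →L[ℝ] ℝ,
      (∀ e, B (e, 0) = z.2 (A (e, 0))) ∧
      HasFDerivAt (fun y : EuclideanSpace ℝ (Fin m) × (EuclideanSpace ℝ (Fin m) →L[ℝ] ℝ) =>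
        y.2 (S.localX β₀.1 u₀ (y.1, extChartAt (𝓡 k) u₀ u))) B z :=
    ⟨_, fun e => by simp [A], (hasFDerivAt_snd (𝕜 := ℝ) (p := z)).clm_apply
      (HasFDerivAt.comp z (g := S.localX β₀.1 u₀) hX.hasFDerivAt
        ((hasFDerivAt_fst (𝕜 := ℝ) (p := z)).prodMk
          (hasFDerivAt_const (extChartAt (𝓡 k) u₀ u) z)))⟩
  have hcomp := HasMFDerivAt.comp β hloc.hasMFDerivAt hψ.hasMFDerivAt
  have hH := HasMFDerivAt.comp β
    (((S.contMDiff_hamiltonian 0).mdifferentiable (by simp)) (β, u)).hasMFDerivAt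
    ((hasMFDerivAt_id (I := cotangentModel m) β).prodMk (hasMFDerivAt_const (I' := 𝓡 k) u β))
  have hev : (fun β' : Cotangent m M => S.hamiltonian 0 (β', u)) =ᶠ[𝓝 β]
      (fun y : EuclideanSpace ℝ (Fin m) × (EuclideanSpace ℝ (Fin m) →L[ℝ] ℝ) =>
      y.2 (S.localX β₀.1 u₀ (y.1, extChartAt (𝓡 k) u₀ u))) ∘ extChartAt (cotangentModel m) β₀ := by
    filter_upwards [extChartAt_source_mem_nhds' hβ] with β' hβ'
    exact S.hamiltonian_zero_eq_localX hβ' hu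
  have huniq := hasMFDerivAt_unique hH (hcomp.congr_of_eventuallyEq hev)
  ext e
  -- A test vector with coordinates `(e, 0)` isolates the momentum part of `v`: `standardForm` then
  -- reduces to `-v_p(e)`. Its control component is taken to be zero, so the slice of `H` at fixed
  -- `u` suffices.
  obtain ⟨w, hw⟩ := hsurj ((e, 0) : EuclideanSpace ℝ (Fin m) × (EuclideanSpace ℝ (Fin m) →L[ℝ] ℝ))
  let w' : TangentSpace (phaseModel m k) (β, u) := (w, (0 : TangentSpace (𝓡 k) u))
  have h1 : canonicalForm β v.1 w = mfderiv (phaseModel m k) 𝓘(ℝ, ℝ) (S.hamiltonian 0) (β, u) w' :=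
    (presymplecticForm_eq (β, u) v w').symm.trans (hv w')
  have h2 : mfderiv (phaseModel m k) 𝓘(ℝ, ℝ) (S.hamiltonian 0) (β, u) w' =
      B (mfderiv (cotangentModel m)
        𝓘(ℝ, EuclideanSpace ℝ (Fin m) × (EuclideanSpace ℝ (Fin m) →L[ℝ] ℝ))
        (extChartAt (cotangentModel m) β₀) β w) :=
    congrArg (fun L : TangentSpace (cotangentModel m) β →L[ℝ] ℝ => L w) huniq
  have h3 := ((canonicalForm_eq_standardForm hβ v.1 w).symm.trans h1).trans h2
  rw [hw] at h3
  refine neg_eq_iff_eq_neg.1 (Eq.trans ?_ (h3.trans (hB e)))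
  simp only [standardForm, zero_apply, zero_sub]

/-! ### Propagation of zeros of the momentum. -/

/-- Linear differential equations preserve the zero vector. -/
theorem eq_zero_of_hasDerivWithinAt_clm {F : Type*} [NormedAddCommGroup F] [NormedSpace ℝ F]
    {f : ℝ → F} {A : ℝ → F →L[ℝ] F} {J : Set ℝ} [J.OrdConnected] {K : NNReal}
    (hA : ∀ t ∈ J, ‖A t‖₊ ≤ K) (hf : ∀ t ∈ J, HasDerivWithinAt f (A t (f t)) J t)
    {s t : ℝ} (hs : s ∈ J) (ht : t ∈ J) (h0 : f s = 0) : f t = 0 := by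
  have hlip : ∀ r ∈ J, LipschitzOnWith K (fun x => A r x) Set.univ := fun r hr =>
    ((A r).lipschitz.weaken (hA r hr)).lipschitzOnWith
  have hcont : ContinuousOn f J := fun r hr => (hf r hr).continuousWithinAt
  rcases le_total s t with hst | hst
  -- Uniqueness is applied against the zero solution, forward in time here and backward in the other
  -- case.
  · have hsub : Set.Icc s t ⊆ J := Set.Icc_subset J hs ht
    refine ODE_solution_unique_of_mem_Icc_right (v := fun r x => A r x) (g := fun _ => 0)
      (fun r hr => hlip r (hsub ⟨hr.1, hr.2.le⟩)) (hcont.mono hsub) (fun r hr => ?_)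
      (fun _ _ => Set.mem_univ _) continuousOn_const (fun r _ => ?_) (fun _ _ => Set.mem_univ _)
      h0 ⟨hst, le_rfl⟩
    · have h := (hf r (hsub ⟨hr.1, hr.2.le⟩)).mono
        ((Set.Icc_subset_Icc_left hr.1).trans hsub)
      exact h.mono_of_mem_nhdsWithin (Icc_mem_nhdsGE hr.2)
    · simpa using hasDerivWithinAt_const r (Set.Ici r) (0 : F)
  · have hsub : Set.Icc t s ⊆ J := Set.Icc_subset J ht hs
    refine ODE_solution_unique_of_mem_Icc_left (v := fun r x => A r x) (g := fun _ => 0)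
      (fun r hr => hlip r (hsub ⟨hr.1.le, hr.2⟩)) (hcont.mono hsub) (fun r hr => ?_)
      (fun _ _ => Set.mem_univ _) continuousOn_const (fun r _ => ?_) (fun _ _ => Set.mem_univ _)
      h0 ⟨le_rfl, hst⟩
    · have h := (hf r (hsub ⟨hr.1.le, hr.2⟩)).mono
        ((Set.Icc_subset_Icc_right hr.2).trans hsub)
      exact h.mono_of_mem_nhdsWithin (Icc_mem_nhdsLE hr.1)
    · simpa using hasDerivWithinAt_const r (Set.Iic r) (0 : F)

/-- The coordinate momentum is `β.2` composed with a linear isomorphism. -/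
theorem cotangent_extChartAt_snd_eq_zero_iff {β₀ β : Cotangent m M}
    (hβ : β ∈ (extChartAt (cotangentModel m) β₀).source) :
    (extChartAt (cotangentModel m) β₀ β).2 = 0 ↔ β.2 = 0 := by
  rw [cotangent_extChartAt]
  constructor
  · intro h
    ext e
    have hx := mem_cotangent_extChartAt_source.1 hβ
    rw [← symmL_trivializationAt_continuousLinearMapAt hx e]
    have := congrArg (fun L : EuclideanSpace ℝ (Fin m) →L[ℝ] ℝ => L
      ((trivializationAt (EuclideanSpace ℝ (Fin m)) (TangentSpace (𝓡 m)) β₀.1).continuousLinearMapAt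
        ℝ β.1 e)) h
    exact this
  · intro h
    ext e
    have := congrArg (fun L : TangentSpace (𝓡 m) β.1 →L[ℝ] ℝ => L
      ((trivializationAt (EuclideanSpace ℝ (Fin m)) (TangentSpace (𝓡 m)) β₀.1).symmL ℝ β.1 e)) h
    exact this

/-- Along the solutions of Hamilton's equations with `p₀ = 0`, the vanishing of the momentum is
locally constant. -/
theorem System.eventually_eq_zero_iff (S : System m k M U) {a b : ℝ}
    {lam : ℝ → Cotangent m M} {u : ℝ → U}
    (h : ∀ t ∈ Set.Icc a b, ∃ v : TangentSpace (phaseModel m k) (lam t, u t),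
      HasMFDerivWithinAt 𝓘(ℝ, ℝ) (phaseModel m k) (fun s => (lam s, u s)) (Set.Icc a b) t
        ((1 : ℝ →L[ℝ] ℝ).smulRight v) ∧ SolvesAt (S.hamiltonian 0) (lam t, u t) v)
    {t₀ : ℝ} (ht₀ : t₀ ∈ Set.Icc a b) :
    ∀ᶠ t in 𝓝[Set.Icc a b] t₀, ((lam t₀).2 = 0 ↔ (lam t).2 = 0) := by
  set β₀ := lam t₀ with hβ₀
  set u₀ := u t₀ with hu₀
  set ψ := extChartAt (cotangentModel m) β₀ with hψ
  set θ := extChartAt (𝓡 k) u₀ with hθ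
  have hcont : ∀ t ∈ Set.Icc a b,
      ContinuousWithinAt (fun s => (lam s, u s)) (Set.Icc a b) t := fun t ht => by
    obtain ⟨v, hv, -⟩ := h t ht
    exact hv.continuousWithinAt
  have hlam : ContinuousWithinAt lam (Set.Icc a b) t₀ := (hcont t₀ ht₀).fst
  have hu : ContinuousWithinAt u (Set.Icc a b) t₀ := (hcont t₀ ht₀).snd
  have hz : ContinuousWithinAt (fun t => ((ψ (lam t)).1, θ (u t))) (Set.Icc a b) t₀ :=
    (((continuousAt_extChartAt β₀).comp_continuousWithinAt hlam).fst).prodMk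
      ((continuousAt_extChartAt u₀).comp_continuousWithinAt hu)
  have hX : ContDiffAt ℝ ∞ (S.localX β₀.1 u₀) ((ψ (lam t₀)).1, θ (u t₀)) := by
    rw [hψ, cotangent_extChartAt]
    exact S.contDiffAt_localX β₀.1 u₀
  have hX1 : ∀ᶠ z in 𝓝 ((ψ (lam t₀)).1, θ (u t₀)), DifferentiableAt ℝ (S.localX β₀.1 u₀) z :=
    ((hX.of_le (by norm_cast : (1 : WithTop ℕ∞) ≤ ∞)).eventually (by simp)).mono
      fun z hz => hz.differentiableAt one_ne_zero
  -- Continuity of the derivative of `localX` bounds it near the base point by its norm there plus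
  -- one; this is the Lipschitz constant `K` of the linear equation.
  have hX2 : ∀ᶠ z in 𝓝 ((ψ (lam t₀)).1, θ (u t₀)), ‖fderiv ℝ (S.localX β₀.1 u₀) z‖₊ <
      ‖fderiv ℝ (S.localX β₀.1 u₀) ((ψ (lam t₀)).1, θ (u t₀))‖₊ + 1 :=
    ((hX.fderiv_right (m := 0) (by norm_cast)).continuousAt.nnnorm).eventually_lt_const
      (lt_add_one _)
  set K := ‖fderiv ℝ (S.localX β₀.1 u₀) ((ψ (lam t₀)).1, θ (u t₀))‖₊ + 1
  have hev := (hlam.eventually (extChartAt_source_mem_nhds (I := cotangentModel m) β₀)).and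
    ((hu.eventually (extChartAt_source_mem_nhds (I := 𝓡 k) u₀)).and
      (hz.eventually (hX1.and hX2)))
  obtain ⟨ε, hε, hball⟩ := Metric.mem_nhdsWithin_iff.1 hev
  have hJ : (Metric.ball t₀ ε ∩ Set.Icc a b).OrdConnected := by
    rw [Real.ball_eq_Ioo]
    exact Set.OrdConnected.inter Set.ordConnected_Ioo Set.ordConnected_Icc
  -- `A t` is the operator `p ↦ -p ∘ ∂ₓX` along the curve; restriction to the `x`-directions does
  -- not increase the norm, so the bound `K` passes to it.
  let A : ℝ → (EuclideanSpace ℝ (Fin m) →L[ℝ] ℝ) →L[ℝ] (EuclideanSpace ℝ (Fin m) →L[ℝ] ℝ) := fun t =>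
    -(ContinuousLinearMap.compL ℝ _ _ ℝ).flip
      ((fderiv ℝ (S.localX β₀.1 u₀) ((ψ (lam t)).1, θ (u t))).comp (ContinuousLinearMap.inl ℝ _ _))
  have hA : ∀ t ∈ Metric.ball t₀ ε ∩ Set.Icc a b, ‖A t‖₊ ≤ K := by
    intro t ht
    refine le_trans ?_ (hball ht).2.2.2.le
    refine ContinuousLinearMap.opNorm_le_bound _ (norm_nonneg _) fun p => ?_
    change ‖-(p.comp ((fderiv ℝ (S.localX β₀.1 u₀) ((ψ (lam t)).1, θ (u t))).comp
      (ContinuousLinearMap.inl ℝ _ _)))‖ ≤ _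
    rw [norm_neg, mul_comm]
    refine (ContinuousLinearMap.opNorm_comp_le _ _).trans
      (mul_le_mul_of_nonneg_left ?_ (norm_nonneg _))
    exact (ContinuousLinearMap.opNorm_comp_le _ _).trans (mul_le_of_le_one_right (norm_nonneg _)
      (ContinuousLinearMap.norm_inl_le_one ..))
  have hderiv : ∀ t ∈ Metric.ball t₀ ε ∩ Set.Icc a b,
      HasDerivWithinAt (fun t => (ψ (lam t)).2) (A t (ψ (lam t)).2)
        (Metric.ball t₀ ε ∩ Set.Icc a b) t := by
    intro t ht
    obtain ⟨hsrc, husrc, hdiff, -⟩ := hball ht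
    obtain ⟨v, hv, hsol⟩ := h t ht.2
    have hfst : HasMFDerivWithinAt 𝓘(ℝ, ℝ) (cotangentModel m) lam (Set.Icc a b) t
        ((1 : ℝ →L[ℝ] ℝ).smulRight v.1) := by
      refine (hasMFDerivAt_fst (lam t, u t)).comp_hasMFDerivWithinAt t hv
    have hd := hasDerivWithinAt_comp_of_hasMFDerivWithinAt
      (mdifferentiableAt_extChartAt (I := cotangentModel m) (x := β₀)
        (by rwa [extChartAt_source] at hsrc)) hfst
    have hd2 := (hasFDerivAt_snd (𝕜 := ℝ)).comp_hasDerivWithinAt t hd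
    refine (hd2.congr_deriv ?_).mono Set.inter_subset_right
    exact S.snd_mfderiv_eq_of_solvesAt hsrc husrc hdiff hsol
  have hmem₀ : t₀ ∈ Metric.ball t₀ ε ∩ Set.Icc a b := ⟨Metric.mem_ball_self hε, ht₀⟩
  filter_upwards [inter_mem_nhdsWithin (Set.Icc a b) (Metric.ball_mem_nhds t₀ hε)] with t ht
  have ht' : t ∈ Metric.ball t₀ ε ∩ Set.Icc a b := ⟨ht.2, ht.1⟩
  rw [← cotangent_extChartAt_snd_eq_zero_iff (hball hmem₀).1,
    ← cotangent_extChartAt_snd_eq_zero_iff (hball ht').1]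
  exact ⟨eq_zero_of_hasDerivWithinAt_clm hA hderiv hmem₀ ht',
    eq_zero_of_hasDerivWithinAt_clm hA hderiv ht' hmem₀⟩

/-- Having equivalent vanishing conditions is an equivalence relation on times that holds locally,
hence throughout the connected interval. -/
theorem System.eq_zero_of_eq_zero (S : System m k M U) {a b : ℝ}
    {lam : ℝ → Cotangent m M} {u : ℝ → U}
    (h : ∀ t ∈ Set.Icc a b, ∃ v : TangentSpace (phaseModel m k) (lam t, u t),
      HasMFDerivWithinAt 𝓘(ℝ, ℝ) (phaseModel m k) (fun s => (lam s, u s)) (Set.Icc a b) t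
        ((1 : ℝ →L[ℝ] ℝ).smulRight v) ∧ SolvesAt (S.hamiltonian 0) (lam t, u t) v)
    {s t : ℝ} (hs : s ∈ Set.Icc a b) (ht : t ∈ Set.Icc a b) (h0 : (lam s).2 = 0) :
    (lam t).2 = 0 :=
  (isPreconnected_Icc.induction₂ (fun s t => (lam s).2 = 0 ↔ (lam t).2 = 0)
    (fun _ hx => S.eventually_eq_zero_iff h hx) (fun _ _ _ _ _ _ => Iff.trans)
    (fun _ _ _ _ => Iff.symm) hs ht).1 h0

/-! ### From final curves to extremals. -/

/-- The two values of `p₀` are treated together: `hne` asks for a nonzero momentum at a single time,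
and is vacuous for `p₀ = -1`, where `(p₀, λ)` is never zero. -/
theorem System.satisfiesPMP_of_isFinalCurve (S : System m k M U) {p₀ a b : ℝ}
    {lam : ℝ → Cotangent m M} {u : ℝ → U} (h : IsFinalCurve (S.hamiltonian p₀) a b lam u)
    (hne : p₀ = 0 → ∃ t ∈ Set.Icc a b, (lam t).2 ≠ 0) : S.SatisfiesPMP p₀ a b lam u := by
  refine ⟨fun t ht => h.hasMFDerivWithinAt ht, exists_eq_of_solvesAt
    ((S.contMDiff_hamiltonian p₀).mdifferentiable (by simp)) fun t ht => h.hasMFDerivWithinAt ht, ?_⟩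
  rintro t ht ⟨rfl, h0⟩
  obtain ⟨s, hs, hs0⟩ := hne rfl
  exact hs0 (S.eq_zero_of_eq_zero (fun t ht => h.hasMFDerivWithinAt ht) ht hs h0)

end OptimalControl

end
theorem propositionc3 {m k : ℕ} {M : Type*} [TopologicalSpace M] [T2Space M]
    [SecondCountableTopology M] [ChartedSpace (EuclideanSpace ℝ (Fin m)) M]
    [IsManifold (𝓡 m) ∞ M] (U : TopologicalSpace.Opens (EuclideanSpace ℝ (Fin k)))
    (S : OptimalControl.System m k M U) (a b : ℝ) (hab : a < b) (γ : ℝ → M)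
    (lam₀ lam₁ : ℝ → OptimalControl.Cotangent m M) (u₀ u₁ : ℝ → U)
    (h₀ : OptimalControl.IsFinalCurve (S.hamiltonian 0) a b lam₀ u₀)
    (hne : ∃ t ∈ Set.Icc a b, (lam₀ t).2 ≠ 0)
    (h₁ : OptimalControl.IsFinalCurve (S.hamiltonian (-1)) a b lam₁ u₁)
    (hγ₀ : ∀ t ∈ Set.Icc a b, (lam₀ t).1 = γ t)
    (hγ₁ : ∀ t ∈ Set.Icc a b, (lam₁ t).1 = γ t) :
    (∃ u : ℝ → U, S.IsAbnormalExtremal a b γ u) ∧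
      (∃ u : ℝ → U, S.IsNormalExtremal a b γ u) := by
  exact ⟨⟨u₀, lam₀, hγ₀, S.satisfiesPMP_of_isFinalCurve h₀ fun _ => hne⟩,
    ⟨u₁, lam₁, hγ₁, S.satisfiesPMP_of_isFinalCurve h₁ fun h => by norm_num at h⟩⟩
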